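/- Let $S$ be a semitopological semigroup, i.e. a semigroup with a Hausdorff topology such that for each $t\in S$ the maps $s\mapsto ts$ and $s\mapsto st$ are continuous. Let $C$ be a nonempty closed convex subset of a complex Hilbert space $H$, and let $\mathcal S=\{T_s : s\in S\}$ be a representation of $S$ on $C$ by nonexpansive maps: each $T_s$ maps $C$ into $C$, $T_{st}x=T_s(T_tx)$, and $\|T_sx-T_sy\|\le\|x-y\|$ for all $s,t\in S$ and $x,y\in C$. Let $c\in C$ be such that the orbit $\{T_sc : s\in S\}$ is bounded. Let $C_b(S)$ be the Banach space of bounded continuous complex-valued functions on $S$ with the supremum norm, and for $s\in S$, $f\in C_b(S)$ put $(\ell_sf)(t)=f(st)$. Let $LUC(S)$ be the set of $f\in C_b(S)$ for which $s\mapsto \ell_sf$ is norm continuous from $S$ to $C_b(S)$, and let $AP(S)$ (respectively $WAP(S)$) be the set of $f\in C_b(S)$ for which $\{\ell_sf : s\in S\}$ is relatively compact in the norm (respectively weak) topology of $C_b(S)$. If $X$ is one of these four spaces, a left invariant mean (LIM) on $X$ is a functional $m\in X^*$ with $\|m\|=m(1)=1$ and $m(\ell_sf)=m(f)$ for all $s\in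 S$, $f\in X$. $S$ is called left amenable if $LUC(S)$ has a LIM. "Weakly" means that $C$ carries the topology (and uniformity) induced by the weak topology of $H$; the action is quasi-equicontinuous if the closure of $\{T_s : s\in S\}$ in the product space $C^C$ consists of continuous maps only. Suppose that at least one of the following conditions holds: 1. $C_b(S)$ has a LIM and $s\mapsto T_sc$ is weakly continuous from $S$ to $C$; 2. $S$ is left amenable and the action $(s,x)\mapsto T_sx$ of $S$ on $C$ is weakly jointly continuous; 3. $AP(S)$ has a LIM and the action of $S$ on $C$ is weakly separately continuous and weakly equicontinuous; 4. $WAP(S)$ has a LIM and the action of $S$ on $C$ is weakly separately continuous and weakly quasi-equicontinuous. Then $S$ has a common fixed point in $C$: there is $x\in C$ with $T_sx=x$ for all $s\in S$. -/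

import Mathlib

open scoped Topology BoundedContinuousFunction

section Translates

variable {S : Type*} [Semigroup S] [TopologicalSpace S] [SeparatelyContinuousMul S]

/-- The left translate `ℓ_s f`, `(ℓ_s f)(t) = f (s t)`, of a bounded continuous function. -/
noncomputable def leftTranslate (s : S) (f : S →ᵇ ℂ) : S →ᵇ ℂ :=
  f.compContinuous ⟨fun t => s * t, SeparatelyContinuousMul.continuous_const_mul⟩

@[simp] theorem leftTranslate_apply (s : S) (f : S →ᵇ ℂ) (t : S) :
    leftTranslate s f t = f (s * t) := rfl

theorem leftTranslate_leftTranslate (s t : S) (f : S →ᵇ ℂ) :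
    leftTranslate t (leftTranslate s f) = leftTranslate (s * t) f := by
  ext u; simp [mul_assoc]

theorem leftTranslate_add (s : S) (f g : S →ᵇ ℂ) :
    leftTranslate s (f + g) = leftTranslate s f + leftTranslate s g := by
  ext u; simp

theorem leftTranslate_smul (s : S) (a : ℂ) (f : S →ᵇ ℂ) :
    leftTranslate s (a • f) = a • leftTranslate s f := by
  ext u; simp

theorem leftTranslate_one (s : S) : leftTranslate s (1 : S →ᵇ ℂ) = 1 := by
  ext u; simp

theorem leftTranslate_zero (s : S) : leftTranslate s (0 : S →ᵇ ℂ) = 0 := by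
  ext u; simp

/-- The left orbit `LO(f) = {ℓ_s f : s ∈ S}`. -/
def leftOrbit (f : S →ᵇ ℂ) : Set (S →ᵇ ℂ) := Set.range fun s => leftTranslate s f

theorem leftOrbit_translate_subset (s : S) (f : S →ᵇ ℂ) :
    leftOrbit (leftTranslate s f) ⊆ leftOrbit f := by
  rintro _ ⟨t, rfl⟩
  exact ⟨s * t, (leftTranslate_leftTranslate s t f).symm⟩

theorem leftOrbit_one_subset : leftOrbit (1 : S →ᵇ ℂ) ⊆ {1} := by
  rintro _ ⟨t, rfl⟩
  exact leftTranslate_one t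

theorem leftOrbit_zero_subset : leftOrbit (0 : S →ᵇ ℂ) ⊆ {0} := by
  rintro _ ⟨t, rfl⟩
  exact leftTranslate_zero t

end Translates

/-- A linear subspace of `C_b(S)` that contains the constant functions and is invariant under
left translations. -/
structure InvariantSubspace (S : Type*) [Semigroup S] [TopologicalSpace S]
    [SeparatelyContinuousMul S] where
  /-- The underlying linear subspace. -/
  carrier : Submodule ℂ (S →ᵇ ℂ)
  one_mem : (1 : S →ᵇ ℂ) ∈ carrier
  translate_mem : ∀ (s : S) (f : S →ᵇ ℂ), f ∈ carrier → leftTranslate s f ∈ carrier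

section Means

variable {S : Type*} [Semigroup S] [TopologicalSpace S] [SeparatelyContinuousMul S]

/-- `m ∈ X*` is a mean: `‖m‖ = m(1) = 1`, the norm being the dual norm for the supremum norm. -/
def IsMean (X : InvariantSubspace S) (m : X.carrier →L[ℂ] ℂ) : Prop :=
  ‖m‖ = 1 ∧ m ⟨1, X.one_mem⟩ = 1

/-- `m` is a left invariant mean on `X`: a mean with `m(ℓ_s f) = m(f)`. -/
def IsLeftInvariantMean (X : InvariantSubspace S) (m : X.carrier →L[ℂ] ℂ) : Prop :=
  IsMean X m ∧
    ∀ (s : S) (f : X.carrier), m ⟨leftTranslate s f, X.translate_mem s f f.2⟩ = m f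

/-- `X` has a left invariant mean. -/
def HasLIM (X : InvariantSubspace S) : Prop :=
  ∃ m : X.carrier →L[ℂ] ℂ, IsLeftInvariantMean X m

variable (S)

/-- `C_b(S)`, all bounded continuous complex functions. -/
noncomputable def CbSpace : InvariantSubspace S where
  carrier := ⊤
  one_mem := trivial
  translate_mem _ _ _ := trivial

/-- `LUC(S)`: those `f` for which `s ↦ ℓ_s f` is continuous from `S` to `C_b(S)` with the
supremum norm. -/
noncomputable def LUCSpace : InvariantSubspace S where
  carrier :=
    { carrier := {f | Continuous fun s : S => leftTranslate s f}
      add_mem' := by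
        intro f g hf hg
        simp only [Set.mem_ofPred_eq, leftTranslate_add] at *
        exact hf.add hg
      zero_mem' := by
        simp only [Set.mem_ofPred_eq, leftTranslate_zero]
        exact continuous_const
      smul_mem' := by
        intro a f hf
        simp only [Set.mem_ofPred_eq, leftTranslate_smul] at *
        exact hf.const_smul a }
  one_mem := by
    change Continuous fun s : S => leftTranslate s 1
    simp only [leftTranslate_one]
    exact continuous_const
  translate_mem s f hf := by
    change Continuous fun t : S => leftTranslate t (leftTranslate s f)
    simp only [leftTranslate_leftTranslate]
    exact Continuous.comp (g := fun u : S => leftTranslate u f) hf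
      SeparatelyContinuousMul.continuous_const_mul

/-- `AP(S)`: those `f` whose left orbit is relatively compact in the norm topology. -/
noncomputable def APSpace : InvariantSubspace S where
  carrier :=
    { carrier := {f | IsCompact (closure (leftOrbit f))}
      add_mem' := by
        intro f g hf hg
        refine (hf.add hg).closure_of_subset ?_
        rintro _ ⟨s, rfl⟩
        exact ⟨_, subset_closure ⟨s, rfl⟩, _, subset_closure ⟨s, rfl⟩,
          (leftTranslate_add s f g).symm⟩
      zero_mem' := isCompact_singleton.closure_of_subset leftOrbit_zero_subset
      smul_mem' := by
        intro a f hf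
        refine (hf.image (continuous_const_smul a)).closure_of_subset ?_
        rintro _ ⟨s, rfl⟩
        exact ⟨_, subset_closure ⟨s, rfl⟩, (leftTranslate_smul s a f).symm⟩ }
  one_mem := isCompact_singleton.closure_of_subset leftOrbit_one_subset
  translate_mem s f hf :=
    IsCompact.closure_of_subset hf ((leftOrbit_translate_subset s f).trans subset_closure)

/-- `WAP(S)`: those `f` whose left orbit is relatively compact in the weak topology of the Banach
space `C_b(S)`. -/
noncomputable def WAPSpace : InvariantSubspace S where
  carrier :=
    { carrier := {f | IsCompact (closure (toWeakSpace ℂ (S →ᵇ ℂ) '' leftOrbit f))}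
      add_mem' := by
        intro f g hf hg
        refine (hf.add hg).closure_of_subset ?_
        rintro _ ⟨_, ⟨s, rfl⟩, rfl⟩
        exact ⟨_, subset_closure ⟨_, ⟨s, rfl⟩, rfl⟩, _, subset_closure ⟨_, ⟨s, rfl⟩, rfl⟩, by
          change toWeakSpace ℂ (S →ᵇ ℂ) (leftTranslate s f) +
            toWeakSpace ℂ (S →ᵇ ℂ) (leftTranslate s g) = _
          rw [← map_add]; exact congrArg _ (leftTranslate_add s f g).symm⟩
      zero_mem' := (isCompact_singleton (x := toWeakSpace ℂ (S →ᵇ ℂ) 0)).closure_of_subset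
        ((Set.image_mono leftOrbit_zero_subset).trans (by rw [Set.image_singleton]))
      smul_mem' := by
        intro a f hf
        refine (hf.image (continuous_const_smul a)).closure_of_subset ?_
        rintro _ ⟨_, ⟨s, rfl⟩, rfl⟩
        exact ⟨_, subset_closure ⟨_, ⟨s, rfl⟩, rfl⟩, by
          change a • _ = _
          rw [← map_smul]; exact congrArg _ (leftTranslate_smul s a f).symm⟩ }
  one_mem := (isCompact_singleton (x := toWeakSpace ℂ (S →ᵇ ℂ) 1)).closure_of_subset
    ((Set.image_mono leftOrbit_one_subset).trans (by rw [Set.image_singleton]))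
  translate_mem s f hf := IsCompact.closure_of_subset hf
    ((Set.image_mono (leftOrbit_translate_subset s f)).trans subset_closure)

/-- `S` is left amenable: `LUC(S)` has a left invariant mean. -/
def IsLeftAmenable : Prop := HasLIM (LUCSpace S)

end Means

section Representations

/-- `T_{st} x = T_s (T_t x)`. -/
def IsRepresentation {S X : Type*} [Semigroup S] (T : S → X → X) : Prop :=
  ∀ s t x, T (s * t) x = T s (T t x)

/-- The set of common fixed points. -/
def commonFixedPoints {S X : Type*} (T : S → X → X) : Set X := {x | ∀ s, T s x = x}

/-- `(s, x) ↦ T_s x` is continuous in each variable. -/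
def IsSeparatelyContinuous {S X : Type*} [TopologicalSpace S] [TopologicalSpace X]
    (T : S → X → X) : Prop :=
  (∀ s, Continuous (T s)) ∧ ∀ x, Continuous fun s => T s x

/-- `(s, x) ↦ T_s x` is continuous on the product. -/
def IsJointlyContinuous {S X : Type*} [TopologicalSpace S] [TopologicalSpace X]
    (T : S → X → X) : Prop :=
  Continuous fun p : S × X => T p.1 p.2

/-- The closure of `{T_s : s ∈ S}` in the product space `X^X` consists of continuous maps. -/
def IsQuasiEquicontinuous {S X : Type*} [TopologicalSpace X] (T : S → X → X) : Prop :=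
  ∀ R ∈ closure (Set.range T), Continuous R

variable {H : Type*} [NormedAddCommGroup H] [InnerProductSpace ℂ H]

/-- Each `T_s` is nonexpansive for the norm. -/
def IsNonexpansive {S : Type*} {C : Set H} (T : S → C → C) : Prop :=
  ∀ (s : S) (x y : C), ‖(T s x : H) - (T s y : H)‖ ≤ ‖(x : H) - (y : H)‖

/-- The uniform structure that `C` inherits from `H` with its weak topology (as a topological
additive group). -/
@[reducible] noncomputable def weakUniformSpace (C : Set H) : UniformSpace C :=
  UniformSpace.comap (fun x : C => toWeakSpace ℂ H (x : H))
    (IsTopologicalAddGroup.rightUniformSpace (WeakSpace ℂ H))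

/-- The topology that `C` inherits from the weak topology of `H`. -/
@[reducible] noncomputable def weakTopology (C : Set H) : TopologicalSpace C :=
  TopologicalSpace.induced (fun x : C => toWeakSpace ℂ H (x : H)) inferInstance

theorem weakUniformSpace_toTopologicalSpace (C : Set H) :
    (weakUniformSpace C).toTopologicalSpace = weakTopology C := rfl

variable {S : Type*} {C : Set H}

/-- `s ↦ T_s c` is continuous from `S` to `C` with the weak topology. -/
def WeaklyContinuousOrbit [TopologicalSpace S] (T : S → C → C) (c : C) : Prop :=
  @Continuous S C _ (weakTopology C) fun s => T s c

/-- The action is separately continuous when `C` carries the weak topology. -/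
def WeaklySeparatelyContinuous [TopologicalSpace S] (T : S → C → C) : Prop :=
  @IsSeparatelyContinuous S C _ (weakTopology C) T

/-- The action is jointly continuous when `C` carries the weak topology. -/
def WeaklyJointlyContinuous [TopologicalSpace S] (T : S → C → C) : Prop :=
  @IsJointlyContinuous S C _ (weakTopology C) T

/-- The family `{T_s}` is equicontinuous when `C` carries the weak topology and uniformity. -/
def WeaklyEquicontinuous (T : S → C → C) : Prop :=
  @Equicontinuous S C C (weakTopology C) (weakUniformSpace C) T

/-- The action is quasi-equicontinuous when `C` carries the weak topology. -/
def WeaklyQuasiEquicontinuous (T : S → C → C) : Prop :=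
  @IsQuasiEquicontinuous S C (weakTopology C) T

end Representations

/-! ### Means, barycentres and the fixed point argument. -/

section FixedPoint

variable {S : Type*} [Semigroup S] [TopologicalSpace S] [SeparatelyContinuousMul S]

/-! Suppose all coefficients `s ↦ ⟪y, T_s c⟫` lie in a space `X` with a left invariant mean `m`.
Averaging the orbit gives a barycentre `z ∈ C` with `m(⟪y, T_s c⟫) = ⟪y, z⟫`, and `z` is the fixed
point. Indeed, for `w = T_t z`, nonexpansiveness gives `‖T_{ts} c - w‖² ≤ ‖T_s c - z‖²`. If `m`
could be applied to `‖T_s c‖²`, then expanding, averaging and using invariance would leave `‖z - w‖²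
≤ 0`. That function need not belong to `X`, so its mean is replaced by the supremum of `Re m(g)`
over the `g ∈ X` with `Re g ≤ ‖T_s c‖²`. The inequality turns each such `g` into another one whose
mean is larger by `‖z - w‖²`. This is `commonFixedPoints_nonempty_of_hasLIM`.

It remains to place the coefficients in the right space. A ball of `C` is weakly compact and
contains the orbit, and the left translates of a coefficient are pullbacks of the functions `x ↦ ⟪y,
T_s x⟫` on this compact set (`exists_orbit_coefficient`). Joint continuity makes these functions
depend norm continuously on `s` (LUC), equicontinuity allows Arzelà–Ascoli (AP), and
quasi-equicontinuity together with Grothendieck's theorem `continuous_apply_of_pointwise` gives weak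
compactness (WAP). For `C_b(S)` boundedness and continuity suffice. -/

theorem IsMean.re_le {X : InvariantSubspace S} {m : X.carrier →L[ℂ] ℂ} (hm : IsMean X m)
    {f : S →ᵇ ℂ} (hf : f ∈ X.carrier) {r : ℝ} (hr : ∀ s, (f s).re ≤ r) :
    (m ⟨f, hf⟩).re ≤ r := by
  refine le_of_forall_pos_le_add fun ε hε => ?_
  -- A half plane is an increasing union of discs: after translation by a large `L`, the imaginary
  -- part costs at most `ε` in the norm, because `(r + L)² + ‖f‖² ≤ (r + L + ε)²`.
  obtain ⟨L, hL⟩ : ∃ L : ℝ, ‖f‖ + |r| + ‖f‖ ^ 2 / (2 * ε) ≤ L := ⟨_, le_rfl⟩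
  have hL0 : ‖f‖ ^ 2 ≤ 2 * ε * (L + r) := by
    have h1 : ‖f‖ ^ 2 / (2 * ε) ≤ L + r := by
      have := neg_abs_le r
      have := norm_nonneg f
      linarith
    rwa [div_le_iff₀' (by positivity)] at h1
  have hq : 0 ≤ ‖f‖ ^ 2 / (2 * ε) := by positivity
  have hLr : 0 ≤ L + r := by
    have := neg_abs_le r
    have := norm_nonneg f
    linarith
  have hbound : ‖f + (L : ℂ) • (1 : S →ᵇ ℂ)‖ ≤ r + ε + L := by
    rw [BoundedContinuousFunction.norm_le (by linarith)]
    intro s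
    have h1 : |(f s).re| ≤ ‖f‖ := (Complex.abs_re_le_norm _).trans (f.norm_coe_le_norm s)
    have h2 : (f s).re ^ 2 + (f s).im ^ 2 ≤ ‖f‖ ^ 2 := by
      have := pow_le_pow_left₀ (norm_nonneg _) (f.norm_coe_le_norm s) 2
      rw [Complex.sq_norm, Complex.normSq_apply] at this
      linarith
    have h3 : 0 ≤ (f s).re + L := by
      have := neg_abs_le (f s).re
      have := abs_nonneg r
      linarith
    refine abs_le_of_sq_le_sq' ?_ (by linarith) |>.2
    rw [Complex.sq_norm, Complex.normSq_apply]
    simp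
    nlinarith [hr s, sq_nonneg (f s).re, sq_nonneg ε,
      mul_nonneg h3 (sub_nonneg.2 (hr s)), mul_nonneg hLr (sub_nonneg.2 (hr s))]
  have hmem : f + (L : ℂ) • (1 : S →ᵇ ℂ) ∈ X.carrier :=
    X.carrier.add_mem hf (X.carrier.smul_mem _ X.one_mem)
  have hval : m ⟨_, hmem⟩ = m ⟨f, hf⟩ + L := by
    have : (⟨_, hmem⟩ : X.carrier) = ⟨f, hf⟩ + (L : ℂ) • ⟨1, X.one_mem⟩ := rfl
    rw [this, map_add, map_smul, hm.2]
    simp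
  have h1 := m.le_opNorm ⟨_, hmem⟩
  rw [hm.1, one_mul, hval] at h1
  have h2 := Complex.re_le_norm (m ⟨f, hf⟩ + L)
  rw [Complex.add_re, Complex.ofReal_re] at h2
  have h3 : ‖(⟨_, hmem⟩ : X.carrier)‖ = ‖f + (L : ℂ) • (1 : S →ᵇ ℂ)‖ := rfl
  linarith

variable {H : Type*} [NormedAddCommGroup H] [InnerProductSpace ℂ H] [CompleteSpace H]

/-- The barycentre of a bounded orbit with respect to a mean. -/
theorem IsMean.exists_barycentre {X : InvariantSubspace S} {m : X.carrier →L[ℂ] ℂ}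
    (hm : IsMean X m) {C : Set H} (hclosed : IsClosed C) (hconv : Convex ℝ C) (u : S → C)
    (F : H → X.carrier) (hF : ∀ y s, (F y : S →ᵇ ℂ) s = inner ℂ y (u s : H))
    {r : ℝ} (hr : ∀ s, ‖(u s : H)‖ ≤ r) :
    ∃ z ∈ C, ∀ y, m (F y) = inner ℂ y z := by
  have hadd : ∀ x y, F (x + y) = F x + F y := fun x y => by
    ext s; simp [hF]
  have hsmul : ∀ (a : ℂ) y, F (a • y) = (starRingEnd ℂ a) • F y := fun a y => by
    ext s; simp [hF, mul_comm]
  -- The inner product is conjugate linear in its first variable, so a conjugation is needed to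
  -- obtain a linear functional for the Riesz representation.
  let L : H →ₗ[ℂ] ℂ :=
    { toFun := fun y => starRingEnd ℂ (m (F y))
      map_add' := fun x y => by simp [hadd]
      map_smul' := fun a y => by simp [hsmul] }
  have hL : ∀ y, ‖L y‖ ≤ r * ‖y‖ := by
    intro y
    rcases isEmpty_or_nonempty S with hS | ⟨⟨s₀⟩⟩
    -- On an empty `S` the functions 0 and 1 coincide, which contradicts `m(1) = 1`.
    · have : F y = 0 := by ext s; exact (hS.false s).elim
      have h1 : (1 : S →ᵇ ℂ) = 0 := by ext s; exact (hS.false s).elim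
      have h2 : (⟨1, X.one_mem⟩ : X.carrier) = 0 := Subtype.ext h1
      have := hm.2
      rw [h2, map_zero] at this
      exact absurd this zero_ne_one
    have hr0 : 0 ≤ r := (norm_nonneg _).trans (hr s₀)
    have h1 : ‖L y‖ = ‖m (F y)‖ := RCLike.norm_conj _
    rw [h1]
    have h2 := m.le_opNorm (F y)
    rw [hm.1, one_mul] at h2
    refine h2.trans ?_
    change ‖(F y : S →ᵇ ℂ)‖ ≤ _
    rw [BoundedContinuousFunction.norm_le (by positivity)]
    intro s
    rw [hF]
    refine (norm_inner_le_norm _ _).trans ?_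
    rw [mul_comm]
    gcongr
    exact hr s
  obtain ⟨z, hz⟩ := (InnerProductSpace.toDual ℂ H).surjective (L.mkContinuous r hL)
  have hz' : ∀ y, m (F y) = inner ℂ y z := by
    intro y
    have h1 := congrArg (fun φ : StrongDual ℂ H => φ y) hz
    simp only [InnerProductSpace.toDual_apply_apply, LinearMap.mkContinuous_apply] at h1
    rw [← inner_conj_symm, h1]
    exact (Complex.conj_conj _).symm
  refine ⟨z, ?_, hz'⟩
  -- If `z` were outside `C`, a functional `⟪y, ·⟫` would separate it strictly from `C`, but the
  -- mean preserves the upper bound `v` on the real part.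
  by_contra hzC
  obtain ⟨f, v, hfv, hvz⟩ := RCLike.geometric_hahn_banach_closed_point (𝕜 := ℂ) hconv hclosed hzC
  obtain ⟨y, rfl⟩ := (InnerProductSpace.toDual ℂ H).surjective f
  simp only [InnerProductSpace.toDual_apply_apply] at hfv hvz
  have h1 := hm.re_le (F y).2 (r := v) fun s => by rw [hF]; exact (hfv _ (u s).2).le
  have h2 : (m (F y)).re ≤ v := h1
  rw [hz'] at h2
  exact absurd hvz (not_lt.2 h2)

/-- A nonexpansive representation has a common fixed point as soon as the coefficients of a bounded
orbit belong to a translation invariant space with a left invariant mean. -/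
theorem commonFixedPoints_nonempty_of_hasLIM (X : InvariantSubspace S) (hX : HasLIM X)
    (C : Set H) (hclosed : IsClosed C) (hconv : Convex ℝ C)
    (T : S → C → C) (hrep : IsRepresentation T) (hT : IsNonexpansive T)
    (c : C) (hc : Bornology.IsBounded (Set.range fun s => (T s c : H)))
    (hcoef : ∀ y : H, ∃ f ∈ X.carrier, ∀ s, f s = inner ℂ y (T s c : H)) :
    (commonFixedPoints T).Nonempty := by
  obtain ⟨m, hm, hinv⟩ := hX
  obtain ⟨r, hr⟩ := hc.exists_norm_le
  replace hr : ∀ s, ‖(T s c : H)‖ ≤ r := fun s => hr _ ⟨s, rfl⟩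
  choose f hfX hf using hcoef
  obtain ⟨z, hzC, hz⟩ := hm.exists_barycentre hclosed hconv (fun s => T s c)
    (fun y => ⟨f y, hfX y⟩) hf hr
  refine ⟨⟨z, hzC⟩, fun t => ?_⟩
  set w : C := T t ⟨z, hzC⟩ with hw
  -- The supremum of `A` is a lower mean of `‖T_s c‖²`, a function that need not be in `X`.
  let A : Set ℝ := {a | ∃ g : X.carrier, (∀ s, ((g : S →ᵇ ℂ) s).re ≤ ‖(T s c : H)‖ ^ 2) ∧
    (m g).re = a}
  have hA0 : A.Nonempty := ⟨_, 0, fun s => by simp, rfl⟩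
  have hAb : BddAbove A := by
    refine ⟨r ^ 2, ?_⟩
    rintro _ ⟨g, hg, rfl⟩
    exact hm.re_le g.2 fun s => (hg s).trans (by gcongr; exact hr s)
  have hstep : ∀ a ∈ A, a + ‖z - w‖ ^ 2 ≤ sSup A := by
    rintro _ ⟨g, hg, rfl⟩
    refine le_csSup hAb ?_
    let e : X.carrier := ⟨1, X.one_mem⟩
    let tr : X.carrier → X.carrier := fun h => ⟨leftTranslate t h, X.translate_mem t h h.2⟩
    let fz : X.carrier := ⟨f z, hfX z⟩
    let fw : X.carrier := ⟨f w, hfX w⟩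
    -- This is the lower bound for `‖T_s c‖²` obtained by expanding `‖T_{ts} c - w‖² ≤ ‖T_s c - z‖²`
    -- and replacing `‖T_{ts} c‖²` by `g(ts)`.
    refine ⟨tr g + (2 : ℂ) • fz - (2 : ℂ) • tr fw + ((‖(w : H)‖ ^ 2 - ‖z‖ ^ 2 : ℝ) : ℂ) • e,
      fun s => ?_, ?_⟩
    · have h1 := hT t (T s c) ⟨z, hzC⟩
      rw [← hrep, ← hw] at h1
      have h2 := pow_le_pow_left₀ (norm_nonneg _) h1 2
      rw [@norm_sub_sq ℂ, @norm_sub_sq ℂ, inner_re_symm, inner_re_symm (T s c : H)] at h2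
      have h3 := hg (t * s)
      have h4 : (((tr g + (2 : ℂ) • fz - (2 : ℂ) • tr fw +
          ((‖(w : H)‖ ^ 2 - ‖z‖ ^ 2 : ℝ) : ℂ) • e : X.carrier) : S →ᵇ ℂ) s) =
          (g : S →ᵇ ℂ) (t * s) + 2 * inner ℂ z (T s c : H) - 2 * inner ℂ (w : H) (T (t * s) c : H)
          + ((‖(w : H)‖ ^ 2 - ‖z‖ ^ 2 : ℝ) : ℂ) := by
        simp [tr, fz, fw, e, hf]
      rw [h4]
      simp only [Complex.add_re, Complex.sub_re, Complex.ofReal_re, Complex.mul_re,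
        Complex.re_ofNat, Complex.im_ofNat, zero_mul, sub_zero]
      simp only [RCLike.re_eq_complex_re] at h2
      linarith
    · have e1 : m (tr g) = m g := hinv t g
      have e2 : m (tr fw) = m fw := hinv t fw
      have e3 : m fz = inner ℂ z z := hz z
      have e4 : m fw = inner ℂ (w : H) z := hz w
      have e5 : m e = 1 := hm.2
      have e6 : (inner ℂ z z : ℂ).re = ‖z‖ ^ 2 := by
        rw [inner_self_eq_norm_sq_to_K]; norm_cast
      simp only [map_add, map_sub, map_smul, e1, e2, e3, e4, e5, smul_eq_mul, Complex.add_re,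
        Complex.sub_re, Complex.mul_re, Complex.re_ofNat, Complex.im_ofNat, zero_mul, sub_zero,
        mul_one, Complex.ofReal_re, e6]
      rw [@norm_sub_sq ℂ, inner_re_symm]
      simp only [RCLike.re_eq_complex_re]
      ring
  have hle : sSup A ≤ sSup A - ‖z - w‖ ^ 2 :=
    csSup_le hA0 fun a ha => by linarith [hstep a ha]
  have h0 : ‖z - w‖ ^ 2 = 0 := le_antisymm (by linarith) (by positivity)
  exact Subtype.ext (sub_eq_zero.1 (norm_eq_zero.1 (pow_eq_zero_iff two_ne_zero |>.1 h0))).symm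

end FixedPoint

/-! ### Pointwise compactness implies weak compactness in `C(K)`. -/

section Grothendieck

open Filter MeasureTheory
open scoped NNReal CompactlySupported

/-- Countable tightness and Fréchet–Urysohn property of pointwise compact families of continuous
functions on a compact space. -/
theorem exists_seq_tendsto_pointwise_of_mem_closure {P K E : Type*} [TopologicalSpace P]
    [CompactSpace P] [TopologicalSpace K] [CompactSpace K] [MetricSpace E]
    [SecondCountableTopology E] {F : P → K → E} (hF : ∀ p, Continuous (F p))
    (hF' : ∀ x, Continuous fun p => F p x) {B : Set P} {p₀ : P} (hp₀ : p₀ ∈ closure B) :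
    ∃ u : ℕ → P, (∀ n, u n ∈ B) ∧ ∀ x, Tendsto (fun n => F (u n) x) atTop (𝓝 (F p₀ x)) := by
  -- Compactness of `K^n` makes one finite subset of `B` serve all `n`-tuples at once; the union
  -- over `n` is countable.
  have hfin : ∀ n : ℕ, ∃ b ⊆ B, b.Finite ∧ ∀ x : Fin n → K, ∃ p ∈ b,
      ∀ i, dist (F p (x i)) (F p₀ (x i)) < 1 / ((n : ℝ) + 1) := by
    intro n
    have hopen : ∀ p ∈ B,
        IsOpen {x : Fin n → K | ∀ i, dist (F p (x i)) (F p₀ (x i)) < 1 / ((n : ℝ) + 1)} := by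
      intro p _
      simp only [Set.ofPred_forall]
      refine isOpen_iInter_of_finite fun i => isOpen_lt ?_ continuous_const
      exact ((hF p).comp (continuous_apply i)).dist ((hF p₀).comp (continuous_apply i))
    have hcov : (Set.univ : Set (Fin n → K)) ⊆
        ⋃ p ∈ B, {x : Fin n → K | ∀ i, dist (F p (x i)) (F p₀ (x i)) < 1 / ((n : ℝ) + 1)} := by
      intro x _
      have hnhds : {p | ∀ i, dist (F p (x i)) (F p₀ (x i)) < 1 / ((n : ℝ) + 1)} ∈ 𝓝 p₀ := by
        refine IsOpen.mem_nhds ?_ fun i => ?_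
        · simp only [Set.ofPred_forall]
          exact isOpen_iInter_of_finite fun i =>
            isOpen_lt ((hF' (x i)).dist continuous_const) continuous_const
        · rw [dist_self]; positivity
      obtain ⟨p, hp, hpB⟩ := mem_closure_iff_nhds.1 hp₀ _ hnhds
      exact Set.mem_iUnion₂.2 ⟨p, hpB, hp⟩
    obtain ⟨b, hbB, hbf, hb⟩ := isCompact_univ.elim_finite_subcover_image hopen hcov
    exact ⟨b, hbB, hbf, fun x => by simpa using hb (Set.mem_univ x)⟩
  choose b hbB hbf hb using hfin
  rcases isEmpty_or_nonempty K with hK | hK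
  · obtain ⟨p, hp⟩ := closure_nonempty_iff.1 ⟨p₀, hp₀⟩
    exact ⟨fun _ => p, fun _ => hp, fun x => (hK.false x).elim⟩
  let Q : Set P := insert p₀ (⋃ n, b n)
  have hQ : Q.Countable := (Set.countable_iUnion fun n => (hbf n).countable).insert _
  have : Countable Q := hQ.to_subtype
  let Φ : K → (Q → E) := fun x q => F q x
  have hΦ : Continuous Φ := continuous_pi fun q => hF q
  choose sec hsec using fun y : Set.range Φ => y.2
  -- The `d n` are dense in `K` only as far as the countably many functions indexed by `Q` can tell.
  let d : ℕ → K := fun n => sec (TopologicalSpace.denseSeq (Set.range Φ) n)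
  have hd : ∀ n, Φ (d n) = TopologicalSpace.denseSeq (Set.range Φ) n := fun n => hsec _
  choose u hub hu using fun n => hb n fun i : Fin n => d i
  have hud : ∀ i, Tendsto (fun n => F (u n) (d i)) atTop (𝓝 (F p₀ (d i))) := by
    intro i
    rw [tendsto_iff_dist_tendsto_zero]
    refine squeeze_zero' (Eventually.of_forall fun n => dist_nonneg) ?_
      tendsto_one_div_add_atTop_nhds_zero_nat
    filter_upwards [eventually_gt_atTop i] with n hn
    exact (hu n ⟨i, hn⟩).le
  refine ⟨u, fun n => hbB n (hub n), fun x => ?_⟩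
  -- Let `p` be a limit of `u` along an ultrafilter. Then `F p` and `F p₀` agree on every `d i`,
  -- hence at a limit `x'` of them with `Φ x' = Φ x`. Neither function separates `x'` from `x`, so
  -- they also agree at `x`.
  rw [tendsto_iff_ultrafilter]
  intro U hU
  obtain ⟨p, -, hp⟩ := isCompact_univ.ultrafilter_le_nhds (U.map u) (by simp)
  have hup : ∀ y, Tendsto (fun n => F (u n) y) U (𝓝 (F p y)) := fun y =>
    ((hF' y).tendsto p).comp hp
  have hpd : ∀ i, F p (d i) = F p₀ (d i) := fun i =>
    tendsto_nhds_unique (hup (d i)) ((hud i).mono_left hU)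
  have hxcl : (⟨Φ x, x, rfl⟩ : Set.range Φ) ∈
      closure (Set.range (TopologicalSpace.denseSeq (Set.range Φ))) :=
    TopologicalSpace.denseRange_denseSeq _ _
  obtain ⟨W, hW, hWx⟩ := mem_closure_iff_ultrafilter.1 hxcl
  obtain ⟨V, rfl⟩ : ∃ V : Ultrafilter ℕ,
      V.map (TopologicalSpace.denseSeq (Set.range Φ)) = W := by
    have hW' : TopologicalSpace.denseSeq (Set.range Φ) '' Set.univ ∈ W := by rwa [Set.image_univ]
    exact ⟨_, Ultrafilter.ofComapInfPrincipal_eq_of_map hW'⟩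
  obtain ⟨x', -, hx'⟩ := isCompact_univ.ultrafilter_le_nhds (V.map d) (by simp)
  have hΦx : Φ x' = Φ x := by
    have h1 : Tendsto (fun n => Φ (d n)) V (𝓝 (Φ x')) := (hΦ.tendsto x').comp hx'
    have h2 : Tendsto (fun n => Φ (d n)) V (𝓝 (Φ x)) := by
      simp only [hd]
      exact (continuous_subtype_val.tendsto _).comp hWx
    exact tendsto_nhds_unique h1 h2
  have hQx : ∀ q ∈ Q, F q x' = F q x := fun q hq => congrFun hΦx ⟨q, hq⟩
  have huQ : ∀ n, u n ∈ Q := fun n => Or.inr (Set.mem_iUnion.2 ⟨n, hub n⟩)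
  have h1 : F p x' = F p x := by
    refine tendsto_nhds_unique (hup x') ?_
    simp only [hQx _ (huQ _)]
    exact hup x
  have h2 : F p x' = F p₀ x' := by
    refine tendsto_nhds_unique (((hF p).tendsto x').comp hx') ?_
    have h3 := ((hF p₀).tendsto x').comp hx'
    refine h3.congr fun i => (hpd i).symm
  have h3 : F p x = F p₀ x := by rw [← h1, h2, hQx p₀ (Or.inl rfl)]
  rw [← h3]
  exact hup x

variable {K : Type*} [TopologicalSpace K]

/-- The values of `Λ` on the order interval `[-f, f]`. -/
def valuesOnInterval (Λ : C(K, ℝ) →L[ℝ] ℝ) (f : C_c(K, ℝ≥0)) : Set ℝ :=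
  {a | ∃ g : C(K, ℝ), (∀ x, |g x| ≤ f x) ∧ Λ g = a}

theorem valuesOnInterval_nonempty (Λ : C(K, ℝ) →L[ℝ] ℝ) (f : C_c(K, ℝ≥0)) :
    (valuesOnInterval Λ f).Nonempty := ⟨0, 0, fun x => by simp, map_zero Λ⟩

variable [CompactSpace K]

theorem valuesOnInterval_bddAbove (Λ : C(K, ℝ) →L[ℝ] ℝ) (f : C_c(K, ℝ≥0)) :
    BddAbove (valuesOnInterval Λ f) := by
  obtain ⟨M, hM⟩ := (isCompact_range (map_continuous f)).bddAbove
  refine ⟨‖Λ‖ * M, ?_⟩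
  rintro _ ⟨g, hg, rfl⟩
  refine (le_abs_self _).trans ((Λ.le_opNorm g).trans ?_)
  gcongr
  refine (ContinuousMap.norm_le g M.2).2 ?_
  exact fun x => (hg x).trans (NNReal.coe_le_coe.2 (hM ⟨x, rfl⟩))

theorem sSup_valuesOnInterval_nonneg (Λ : C(K, ℝ) →L[ℝ] ℝ) (f : C_c(K, ℝ≥0)) :
    0 ≤ sSup (valuesOnInterval Λ f) :=
  le_csSup (valuesOnInterval_bddAbove Λ f) ⟨0, fun x => by simp, map_zero Λ⟩

/-- Riesz decomposition: if `|g| ≤ f₁ + f₂`, truncating `g` to `[-f₁, f₁]` leaves a remainder in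
`[-f₂, f₂]`. Additivity makes the supremum a positive functional, the total variation of `Λ`, to
which Riesz–Markov applies. -/
theorem sSup_valuesOnInterval_add (Λ : C(K, ℝ) →L[ℝ] ℝ) (f₁ f₂ : C_c(K, ℝ≥0)) :
    sSup (valuesOnInterval Λ (f₁ + f₂)) =
      sSup (valuesOnInterval Λ f₁) + sSup (valuesOnInterval Λ f₂) := by
  apply le_antisymm
  · refine csSup_le (valuesOnInterval_nonempty Λ _) ?_
    rintro _ ⟨g, hg, rfl⟩
    let φ : C(K, ℝ) := ⟨fun x => f₁ x, by fun_prop⟩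
    let g₁ : C(K, ℝ) := (g ⊓ φ) ⊔ (-φ)
    have hg₁ : ∀ x, g₁ x = max (min (g x) (f₁ x)) (-(f₁ x)) := fun x => rfl
    have h1 : Λ g₁ ≤ sSup (valuesOnInterval Λ f₁) := by
      refine le_csSup (valuesOnInterval_bddAbove Λ f₁) ⟨g₁, fun x => ?_, rfl⟩
      rw [hg₁, abs_le]
      exact ⟨le_max_right _ _, max_le (min_le_right _ _) (by
        have : (0 : ℝ) ≤ f₁ x := (f₁ x).2
        linarith)⟩
    have h2 : Λ (g - g₁) ≤ sSup (valuesOnInterval Λ f₂) := by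
      refine le_csSup (valuesOnInterval_bddAbove Λ f₂) ⟨g - g₁, fun x => ?_, rfl⟩
      rw [ContinuousMap.sub_apply, hg₁]
      have h3 := abs_le.1 (hg x)
      have h4 : (0 : ℝ) ≤ f₁ x := (f₁ x).2
      have h5 : (0 : ℝ) ≤ f₂ x := (f₂ x).2
      have h6 : (((f₁ + f₂) x : ℝ≥0) : ℝ) = f₁ x + f₂ x := by simp
      rw [h6] at h3
      rw [abs_le]
      rcases max_cases (min (g x) (f₁ x)) (-(f₁ x : ℝ)) with ⟨h7, _⟩ | ⟨h7, _⟩ <;>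
      rcases min_cases (g x) (f₁ x : ℝ) with ⟨h8, _⟩ | ⟨h8, _⟩ <;>
      constructor <;> linarith
    have h3 : Λ g = Λ g₁ + Λ (g - g₁) := by rw [← map_add, add_sub_cancel]
    linarith
  · rw [← le_sub_iff_add_le]
    refine csSup_le (valuesOnInterval_nonempty Λ _) ?_
    rintro _ ⟨g₁, hg₁, rfl⟩
    rw [le_sub_comm]
    refine csSup_le (valuesOnInterval_nonempty Λ _) ?_
    rintro _ ⟨g₂, hg₂, rfl⟩
    rw [le_sub_iff_add_le', ← map_add]
    refine le_csSup (valuesOnInterval_bddAbove Λ _) ⟨g₁ + g₂, fun x => ?_, rfl⟩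
    have h6 : (((f₁ + f₂) x : ℝ≥0) : ℝ) = f₁ x + f₂ x := by simp
    rw [h6]
    exact (abs_add_le _ _).trans (add_le_add (hg₁ x) (hg₂ x))

theorem le_sSup_valuesOnInterval_smul (Λ : C(K, ℝ) →L[ℝ] ℝ) (a : ℝ≥0) (f : C_c(K, ℝ≥0)) :
    a * sSup (valuesOnInterval Λ f) ≤ sSup (valuesOnInterval Λ (a • f)) := by
  rcases eq_or_ne a 0 with rfl | ha
  · simpa using sSup_valuesOnInterval_nonneg Λ _
  have ha' : (0 : ℝ) < a := NNReal.coe_pos.2 (pos_iff_ne_zero.2 ha)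
  rw [← le_div_iff₀' ha']
  refine csSup_le (valuesOnInterval_nonempty Λ _) ?_
  rintro _ ⟨g, hg, rfl⟩
  rw [le_div_iff₀' ha']
  refine le_csSup (valuesOnInterval_bddAbove Λ _) ⟨(a : ℝ) • g, fun x => ?_, by simp⟩
  have : (((a • f) x : ℝ≥0) : ℝ) = a * f x := by simp
  rw [this, ContinuousMap.smul_apply, smul_eq_mul, abs_mul, abs_of_pos ha']
  gcongr
  exact hg x

theorem sSup_valuesOnInterval_smul (Λ : C(K, ℝ) →L[ℝ] ℝ) (a : ℝ≥0) (f : C_c(K, ℝ≥0)) :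
    sSup (valuesOnInterval Λ (a • f)) = a * sSup (valuesOnInterval Λ f) := by
  refine le_antisymm ?_ (le_sSup_valuesOnInterval_smul Λ a f)
  rcases eq_or_ne a 0 with rfl | ha
  · rw [zero_smul, NNReal.coe_zero, zero_mul]
    refine csSup_le (valuesOnInterval_nonempty Λ _) ?_
    rintro _ ⟨g, hg, rfl⟩
    have : g = 0 := by
      ext x
      simpa using hg x
    simp [this]
  have ha' : (0 : ℝ) < a := NNReal.coe_pos.2 (pos_iff_ne_zero.2 ha)
  have h := le_sSup_valuesOnInterval_smul Λ a⁻¹ (a • f)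
  rw [smul_smul, inv_mul_cancel₀ ha, one_smul, NNReal.coe_inv, inv_mul_le_iff₀ ha'] at h
  exact h

/-- Every continuous functional on `C(K, ℝ)` is dominated by a finite measure. -/
theorem exists_finiteMeasure_abs_le_integral [T2Space K] [MeasurableSpace K] [BorelSpace K]
    (Λ : C(K, ℝ) →L[ℝ] ℝ) :
    ∃ ν : Measure K, IsFiniteMeasure ν ∧ ∀ g : C(K, ℝ), |Λ g| ≤ ∫ x, |g x| ∂ν := by
  let q : C_c(K, ℝ≥0) →ₗ[ℝ≥0] ℝ≥0 :=
    { toFun := fun f => ⟨sSup (valuesOnInterval Λ f), sSup_valuesOnInterval_nonneg Λ f⟩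
      map_add' := fun f₁ f₂ => NNReal.eq (sSup_valuesOnInterval_add Λ f₁ f₂)
      map_smul' := fun a f => NNReal.eq (sSup_valuesOnInterval_smul Λ a f) }
  have hreg : (NNRealRMK.rieszMeasure q).Regular := inferInstance
  refine ⟨NNRealRMK.rieszMeasure q, inferInstance, fun g => ?_⟩
  let f : C_c(K, ℝ≥0) := CompactlySupportedContinuousMap.continuousMapEquiv
    ⟨fun x => ‖g x‖₊, by fun_prop⟩
  have hf : ∀ x, (f x : ℝ) = |g x| := fun x => rfl
  have h1 := NNRealRMK.integral_rieszMeasure q f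
  simp only [hf] at h1
  rw [h1]
  change |Λ g| ≤ sSup (valuesOnInterval Λ f)
  refine abs_le'.2 ⟨le_csSup (valuesOnInterval_bddAbove Λ f) ⟨g, fun x => (hf x).ge, rfl⟩,
    le_csSup (valuesOnInterval_bddAbove Λ f) ⟨-g, fun x => ?_, map_neg Λ g⟩⟩
  rw [hf, ContinuousMap.neg_apply, abs_neg]

/-- Dominated convergence for the measure dominating `Λ` would settle the matter for sequences; the
Fréchet–Urysohn property reduces a failure of continuity at `p₀` to a sequence. -/
theorem continuous_apply_of_pointwise_real [T2Space K] {P : Type*} [TopologicalSpace P]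
    [CompactSpace P] {F : P → C(K, ℝ)} {M : ℝ} (hM : ∀ p x, |F p x| ≤ M)
    (hF : ∀ x, Continuous fun p => F p x) (Λ : C(K, ℝ) →L[ℝ] ℝ) :
    Continuous fun p => Λ (F p) := by
  let _ : MeasurableSpace K := borel K
  have : BorelSpace K := ⟨rfl⟩
  obtain ⟨ν, hν, hΛ⟩ := exists_finiteMeasure_abs_le_integral Λ
  rw [continuous_iff_continuousAt]
  intro p₀
  rw [ContinuousAt, Metric.tendsto_nhds]
  by_contra! hcon
  obtain ⟨ε, hε, hfr⟩ := hcon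
  have hcl : p₀ ∈ closure {p | ε ≤ dist (Λ (F p)) (Λ (F p₀))} := by
    rw [mem_closure_iff_frequently]
    refine hfr.mono fun p hp => ?_
    simpa using hp
  obtain ⟨u, huB, hu⟩ := exists_seq_tendsto_pointwise_of_mem_closure
    (F := fun p x => F p x) (fun p => (F p).continuous) hF hcl
  have hlim : Tendsto (fun n => ∫ x, |(F (u n) - F p₀) x| ∂ν) atTop (𝓝 (∫ _, (0 : ℝ) ∂ν)) := by
    refine tendsto_integral_of_dominated_convergence (fun _ => 2 * M) (fun n => ?_)
      (integrable_const _) (fun n => ?_) ?_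
    · exact (F (u n) - F p₀).continuous.abs.aestronglyMeasurable
    · refine ae_of_all _ fun x => ?_
      rw [Real.norm_eq_abs, abs_abs, ContinuousMap.sub_apply]
      refine (abs_sub _ _).trans ?_
      linarith [hM (u n) x, hM p₀ x]
    · refine ae_of_all _ fun x => ?_
      have h1 := ((hu x).sub_const (F p₀ x)).abs
      simpa using h1
  rw [integral_zero] at hlim
  refine absurd hε (not_lt.2 (ge_of_tendsto hlim (Eventually.of_forall fun n => ?_)))
  refine (huB n).out.trans ?_
  rw [Real.dist_eq, ← map_sub]
  exact hΛ _

/-- **Grothendieck's theorem**: a bounded family of continuous functions on a compact space that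
depends continuously on a compact parameter for pointwise convergence does so for the weak
topology. -/
theorem continuous_apply_of_pointwise [T2Space K] {P : Type*} [TopologicalSpace P]
    [CompactSpace P] {F : P → C(K, ℂ)} {M : ℝ} (hM : ∀ p x, ‖F p x‖ ≤ M)
    (hF : ∀ x, Continuous fun p => F p x) (Λ : C(K, ℂ) →L[ℂ] ℂ) :
    Continuous fun p => Λ (F p) := by
  let J : C(K, ℝ) →L[ℝ] C(K, ℂ) := Complex.ofRealCLM.compLeftContinuous ℝ K
  let Λ' : C(K, ℝ) →L[ℝ] ℂ := (Λ.restrictScalars ℝ).comp J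
  have key : ∀ G : P → C(K, ℝ), (∀ p x, |G p x| ≤ M) → (∀ x, Continuous fun p => G p x) →
      Continuous fun p => Λ (J (G p)) := by
    intro G hGM hG
    have h1 := continuous_apply_of_pointwise_real hGM hG (Complex.reCLM.comp Λ')
    have h2 := continuous_apply_of_pointwise_real hGM hG (Complex.imCLM.comp Λ')
    have h3 := (Complex.continuous_ofReal.comp h1).add
      ((Complex.continuous_ofReal.comp h2).mul_const Complex.I)
    exact h3.congr fun p => Complex.re_add_im _
  let R : P → C(K, ℝ) := fun p => Complex.reCLM.compLeftContinuous ℝ K (F p)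
  let I : P → C(K, ℝ) := fun p => Complex.imCLM.compLeftContinuous ℝ K (F p)
  have hR := key R (fun p x => (Complex.abs_re_le_norm _).trans (hM p x))
    fun x => Complex.continuous_re.comp (hF x)
  have hI := key I (fun p x => (Complex.abs_im_le_norm _).trans (hM p x))
    fun x => Complex.continuous_im.comp (hF x)
  refine (hR.add (hI.const_smul Complex.I)).congr fun p => ?_
  change Λ (J (R p)) + Complex.I • Λ (J (I p)) = Λ (F p)
  rw [← map_smul, ← map_add]
  congr 1
  ext x
  change ((F p x).re : ℂ) + Complex.I * ((F p x).im : ℂ) = F p x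
  rw [mul_comm, Complex.re_add_im]

end Grothendieck

/-! ### Membership in LUC, AP and WAP through a compact space. -/

section Coefficients

variable {S : Type*} [TopologicalSpace S] {K : Type*} [TopologicalSpace K] [CompactSpace K]

/-- Composition with a continuous map into a compact space. -/
noncomputable def pullbackCLM (π : C(S, K)) : C(K, ℂ) →L[ℂ] (S →ᵇ ℂ) where
  toFun g := (BoundedContinuousFunction.mkOfCompact g).compContinuous π
  map_add' _ _ := rfl
  map_smul' _ _ := rfl
  cont := (BoundedContinuousFunction.continuous_compContinuous π).comp
    (ContinuousMap.isometryEquivBoundedOfCompact K ℂ).continuous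

@[simp] theorem pullbackCLM_apply (π : C(S, K)) (g : C(K, ℂ)) (s : S) :
    pullbackCLM π g s = g (π s) := rfl

variable [Semigroup S] [SeparatelyContinuousMul S] {π : C(S, K)} {f : S →ᵇ ℂ} {h : S → C(K, ℂ)}

theorem mem_LUCSpace_of_continuous (hf : ∀ s, leftTranslate s f = pullbackCLM π (h s))
    (hh : Continuous h) : f ∈ (LUCSpace S).carrier := by
  change Continuous fun s => leftTranslate s f
  simp only [hf]
  exact (pullbackCLM π).continuous.comp hh

/-- Arzelà–Ascoli applies on `K`, since `S` itself need not be compact; the pullback carries norm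
compactness over to `C_b(S)`. -/
theorem mem_APSpace_of_equicontinuous (hf : ∀ s, leftTranslate s f = pullbackCLM π (h s))
    {M : ℝ} (hM : ∀ s x, ‖h s x‖ ≤ M) (hh : Equicontinuous fun s x => h s x) :
    f ∈ (APSpace S).carrier := by
  change IsCompact (closure (leftOrbit f))
  let A : Set (K →ᵇ ℂ) := Set.range fun s => BoundedContinuousFunction.mkOfCompact (h s)
  have hA : IsCompact (closure A) := by
    refine BoundedContinuousFunction.arzela_ascoli (Metric.closedBall 0 M)
      (isCompact_closedBall 0 M) A ?_ ?_
    · rintro _ x ⟨s, rfl⟩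
      exact mem_closedBall_zero_iff.2 (hM s x)
    · intro x U hU
      filter_upwards [hh x U hU] with y hy
      rintro ⟨_, s, rfl⟩
      exact hy s
  refine (hA.image (BoundedContinuousFunction.continuous_compContinuous π)).closure_of_subset ?_
  rintro _ ⟨s, rfl⟩
  exact ⟨_, subset_closure ⟨s, rfl⟩, (hf s).symm⟩

theorem mem_WAPSpace_of_pointwise [T2Space K]
    (hf : ∀ s, leftTranslate s f = pullbackCLM π (h s))
    {P : Type*} [TopologicalSpace P] [CompactSpace P] {F : P → C(K, ℂ)} {M : ℝ}
    (hM : ∀ p x, ‖F p x‖ ≤ M) (hF : ∀ x, Continuous fun p => F p x)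
    (hh : ∀ s, ∃ p, F p = h s) : f ∈ (WAPSpace S).carrier := by
  change IsCompact (closure (toWeakSpace ℂ (S →ᵇ ℂ) '' leftOrbit f))
  have hcont : Continuous fun p => toWeakSpace ℂ (S →ᵇ ℂ) (pullbackCLM π (F p)) :=
    WeakBilin.continuous_of_continuous_eval _ fun Λ =>
      continuous_apply_of_pointwise hM hF (Λ.comp (pullbackCLM π))
  refine (isCompact_range hcont).closure_of_subset ?_
  rintro _ ⟨_, ⟨s, rfl⟩, rfl⟩
  obtain ⟨p, hp⟩ := hh s
  refine ⟨p, ?_⟩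
  simp only [hp, hf]

end Coefficients

/-! ### Coefficients of an orbit contained in a compact set. -/

section Orbits

variable {S : Type*} [Semigroup S] [TopologicalSpace S] [SeparatelyContinuousMul S]
  {X : Type*} [TopologicalSpace X] {T : S → X → X} {K : Set X} {c : X} {φ : X → ℂ}

/-- The function `s ↦ φ (T_s c)` together with its left translates, expressed through functions
on a compact set that contains the orbit of `c`. -/
theorem exists_orbit_coefficient (hrep : IsRepresentation T) (hK : IsCompact K)
    (hcK : ∀ s, T s c ∈ K) (hsep : IsSeparatelyContinuous T) (hφ : Continuous φ) :
    ∃ (_ : CompactSpace K) (π : C(S, K)) (f : S →ᵇ ℂ) (h : S → C(K, ℂ)),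
      (∀ s, f s = φ (T s c)) ∧ (∀ s, leftTranslate s f = pullbackCLM π (h s)) ∧
      ∀ s x, h s x = φ (T s x) := by
  have hKc : CompactSpace K := isCompact_iff_compactSpace.1 hK
  let π : C(S, K) := ⟨fun s => ⟨T s c, hcK s⟩, (hsep.2 c).subtype_mk _⟩
  refine ⟨hKc, π, pullbackCLM π ⟨fun x => φ x, hφ.comp continuous_subtype_val⟩,
    fun s => ⟨fun x => φ (T s x), hφ.comp ((hsep.1 s).comp continuous_subtype_val)⟩,
    fun s => rfl, fun s => ?_, fun s x => rfl⟩
  ext t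
  exact congrArg φ (hrep s t c)

theorem exists_mem_LUCSpace (hrep : IsRepresentation T) (hK : IsCompact K)
    (hcK : ∀ s, T s c ∈ K) (hjoint : IsJointlyContinuous T) (hφ : Continuous φ) :
    ∃ f ∈ (LUCSpace S).carrier, ∀ s, f s = φ (T s c) := by
  have hsep : IsSeparatelyContinuous T :=
    ⟨fun s => hjoint.comp (Continuous.prodMk_right s), fun x => hjoint.comp (.prodMk_left x)⟩
  obtain ⟨_, π, f, h, hf, hfh, hh⟩ := exists_orbit_coefficient hrep hK hcK hsep hφ
  refine ⟨f, mem_LUCSpace_of_continuous hfh ?_, hf⟩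
  refine ContinuousMap.continuous_of_continuous_uncurry _ ?_
  simp only [hh]
  exact hφ.comp (hjoint.comp (continuous_id.prodMap continuous_subtype_val))

theorem exists_mem_APSpace (hrep : IsRepresentation T) (hK : IsCompact K)
    (hcK : ∀ s, T s c ∈ K) (hsep : IsSeparatelyContinuous T) (hφ : Continuous φ)
    {M : ℝ} (hM : ∀ s, ∀ x ∈ K, ‖φ (T s x)‖ ≤ M) (hequi : Equicontinuous fun s x => φ (T s x)) :
    ∃ f ∈ (APSpace S).carrier, ∀ s, f s = φ (T s c) := by
  obtain ⟨_, π, f, h, hf, hfh, hh⟩ := exists_orbit_coefficient hrep hK hcK hsep hφ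
  refine ⟨f, mem_APSpace_of_equicontinuous (M := M) hfh (fun s x => ?_) ?_, hf⟩
  · rw [hh]; exact hM s x x.2
  · simp only [hh]
    intro x U hU
    exact (continuous_subtype_val.tendsto x).eventually (hequi x U hU)

theorem exists_mem_WAPSpace [T2Space X] (hrep : IsRepresentation T) (hK : IsCompact K)
    (hcK : ∀ s, T s c ∈ K) (hsep : IsSeparatelyContinuous T) (hφ : Continuous φ)
    {M : ℝ} (hM : ∀ s, ∀ x ∈ K, ‖φ (T s x)‖ ≤ M) {L : X → Set X} (hL : ∀ x, IsCompact (L x))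
    (hTL : ∀ s x, T s x ∈ L x) (hquasi : IsQuasiEquicontinuous T) :
    ∃ f ∈ (WAPSpace S).carrier, ∀ s, f s = φ (T s c) := by
  obtain ⟨_, π, f, h, hf, hfh, hh⟩ := exists_orbit_coefficient hrep hK hcK hsep hφ
  let P : Set (X → X) := closure (Set.range T)
  -- By Tychonoff the closure of the action is compact, so it can serve as the parameter space in
  -- Grothendieck's theorem; quasi-equicontinuity is what makes its members continuous.
  have hP : IsCompact P := (isCompact_univ_pi hL).closure_of_subset (by
    rintro _ ⟨s, rfl⟩ x _
    exact hTL s x)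
  have hPc : CompactSpace P := isCompact_iff_compactSpace.1 hP
  let F : P → C(K, ℂ) := fun R =>
    ⟨fun x => φ (R.1 x), hφ.comp ((hquasi R.1 R.2).comp continuous_subtype_val)⟩
  have hFM : ∀ R x, ‖F R x‖ ≤ M := by
    intro R x
    have hcl : IsClosed {R : X → X | ‖φ (R x)‖ ≤ M} :=
      isClosed_le (hφ.comp (continuous_apply _)).norm continuous_const
    refine closure_minimal ?_ hcl R.2
    rintro _ ⟨s, rfl⟩
    exact hM s x x.2
  refine ⟨f, mem_WAPSpace_of_pointwise hfh hFM (fun x => ?_) (fun s => ?_), hf⟩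
  · exact hφ.comp ((continuous_apply _).comp continuous_subtype_val)
  · exact ⟨⟨T s, subset_closure ⟨s, rfl⟩⟩, ContinuousMap.ext fun x => (hh s x).symm⟩

end Orbits

/-! ### The weak topology on a closed convex subset of a Hilbert space. -/

section WeakTopology

variable {H : Type*} [NormedAddCommGroup H] [InnerProductSpace ℂ H]

theorem continuous_inner_weakTopology (C : Set H) (y : H) :
    @Continuous C ℂ (weakTopology C) _ fun x => inner ℂ y (x : H) := by
  let _ := weakTopology C
  exact (WeakBilin.eval_continuous (topDualPairing ℂ H).flip (innerSL ℂ y)).comp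
    continuous_induced_dom

theorem uniformContinuous_inner_weakUniformSpace (C : Set H) (y : H) :
    @UniformContinuous C ℂ (weakUniformSpace C) _ fun x => inner ℂ y (x : H) := by
  let _ : UniformSpace (WeakSpace ℂ H) := IsTopologicalAddGroup.rightUniformSpace _
  have : IsUniformAddGroup (WeakSpace ℂ H) := isUniformAddGroup_of_addCommGroup
  let _ := weakUniformSpace C
  let ψ : WeakSpace ℂ H →+ ℂ :=
    (((innerSL ℂ y : H →L[ℂ] ℂ) : H →ₗ[ℂ] ℂ).comp
      ((toWeakSpace ℂ H).symm : WeakSpace ℂ H →ₗ[ℂ] H)).toAddMonoidHom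
  have hψ : Continuous ψ := WeakBilin.eval_continuous (topDualPairing ℂ H).flip (innerSL ℂ y)
  exact (uniformContinuous_addMonoidHom_of_continuous hψ).comp uniformContinuous_comap

theorem t2Space_weakTopology (C : Set H) : @T2Space C (weakTopology C) := by
  let _ := weakTopology C
  exact T2Space.of_injective_continuous (f := fun x : C => toWeakSpace ℂ H (x : H))
    (fun x y h => Subtype.ext ((toWeakSpace ℂ H).injective h)) continuous_induced_dom

variable [CompleteSpace H]

/-- Reflexivity of `H`, from the Riesz representation used on `H` and on its dual. -/
theorem inclusionInDoubleDualWeak_surjective :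
    Function.Surjective (NormedSpace.inclusionInDoubleDualWeak ℂ H) := by
  intro ψ
  let Ψ : StrongDual ℂ (StrongDual ℂ H) := WeakDual.toStrongDual ψ
  let L : H →ₗ[ℂ] ℂ :=
    { toFun := fun y => starRingEnd ℂ (Ψ (InnerProductSpace.toDual ℂ H y))
      map_add' := fun x y => by simp
      map_smul' := fun a y => by
        rw [map_smulₛₗ, map_smul, smul_eq_mul, map_mul, Complex.conj_conj, RingHom.id_apply,
          smul_eq_mul] }
  have hL : ∀ y, ‖L y‖ ≤ ‖Ψ‖ * ‖y‖ := fun y => by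
    have h1 : ‖L y‖ = ‖Ψ (InnerProductSpace.toDual ℂ H y)‖ := RCLike.norm_conj _
    rw [h1]
    simpa using Ψ.le_opNorm (InnerProductSpace.toDual ℂ H y)
  obtain ⟨x, hx⟩ := (InnerProductSpace.toDual ℂ H).surjective (L.mkContinuous _ hL)
  refine ⟨toWeakSpace ℂ H x, ?_⟩
  refine DFunLike.ext _ _ fun g => ?_
  obtain ⟨y, rfl⟩ := (InnerProductSpace.toDual ℂ H).surjective g
  have h1 := congrArg (fun φ : StrongDual ℂ H => starRingEnd ℂ (φ y)) hx
  simp only [InnerProductSpace.toDual_apply_apply, LinearMap.mkContinuous_apply,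
    inner_conj_symm] at h1
  change inner ℂ y x = Ψ _
  rw [h1]
  exact Complex.conj_conj _

/-- By convexity the norm closed set `C ∩ closedBall 0 r` is weakly closed, and bounded sets are
relatively weakly compact by reflexivity. -/
theorem isCompact_weakTopology_norm_le {C : Set H} (hclosed : IsClosed C) (hconv : Convex ℝ C)
    (r : ℝ) : @IsCompact C (weakTopology C) {x | ‖(x : H)‖ ≤ r} := by
  have h1 : IsCompact (toWeakSpace ℂ H '' (C ∩ Metric.closedBall 0 r)) := by
    have h2 : Convex ℝ (C ∩ Metric.closedBall 0 r) := hconv.inter (convex_closedBall 0 r)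
    have h3 := h2.toWeakSpace_closure (𝕜 := ℂ)
    rw [(hclosed.inter Metric.isClosed_closedBall).closure_eq] at h3
    rw [h3]
    refine NormedSpace.isCompact_closure_of_isBounded ℂ H _ ?_ fun x _ =>
      inclusionInDoubleDualWeak_surjective x
    rw [Set.preimage_image_eq _ (toWeakSpace ℂ H).injective]
    exact Metric.isBounded_closedBall.subset Set.inter_subset_right
  let _ := weakTopology C
  have hind : Topology.IsInducing fun x : C => toWeakSpace ℂ H (x : H) := ⟨rfl⟩
  rw [hind.isCompact_iff]
  convert h1 using 1
  ext w
  constructor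
  · rintro ⟨x, hx, rfl⟩
    exact ⟨x, ⟨x.2, mem_closedBall_zero_iff.2 hx⟩, rfl⟩
  · rintro ⟨x, ⟨hxC, hx⟩, rfl⟩
    exact ⟨⟨x, hxC⟩, mem_closedBall_zero_iff.1 hx, rfl⟩

end WeakTopology

theorem mainTheorem1 {S : Type*} [Semigroup S] [TopologicalSpace S] [T2Space S]
    [SeparatelyContinuousMul S]
    {H : Type*} [NormedAddCommGroup H] [InnerProductSpace ℂ H] [CompleteSpace H]
    (C : Set H) (hne : C.Nonempty) (hclosed : IsClosed C) (hconv : Convex ℝ C)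
    (T : S → C → C) (hrep : IsRepresentation T) (hT : IsNonexpansive T)
    (c : C) (hc : Bornology.IsBounded (Set.range fun s => (T s c : H)))
    (hcond :
      (HasLIM (CbSpace S) ∧ WeaklyContinuousOrbit T c) ∨
      (IsLeftAmenable S ∧ WeaklyJointlyContinuous T) ∨
      (HasLIM (APSpace S) ∧ WeaklySeparatelyContinuous T ∧ WeaklyEquicontinuous T) ∨
      (HasLIM (WAPSpace S) ∧ WeaklySeparatelyContinuous T ∧ WeaklyQuasiEquicontinuous T)) :
    (commonFixedPoints T).Nonempty := by
  have key := fun X hX =>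
    commonFixedPoints_nonempty_of_hasLIM X hX C hclosed hconv T hrep hT c hc
  obtain ⟨r, hr⟩ := hc.exists_norm_le
  replace hr : ∀ s, ‖(T s c : H)‖ ≤ r := fun s => hr _ ⟨s, rfl⟩
  have hcompact := isCompact_weakTopology_norm_le hclosed hconv
  -- Nonexpansiveness bounds every orbit, not only that of `c`; this supplies the compact sets for
  -- Tychonoff and the uniform bounds on coefficients.
  have hbound : ∀ s (x : C), ‖(T s x : H)‖ ≤ r + ‖(x : H) - c‖ := by
    intro s x
    have h1 := norm_add_le (T s c : H) (T s x - T s c)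
    rw [add_sub_cancel] at h1
    exact h1.trans (add_le_add (hr s) (hT s x c))
  have hM : ∀ (y : H) (s : S), ∀ x ∈ {x : C | ‖(x : H)‖ ≤ r},
      ‖(inner ℂ y (T s x : H) : ℂ)‖ ≤ ‖y‖ * (r + (r + ‖(c : H)‖)) := by
    intro y s x hx
    refine (norm_inner_le_norm _ _).trans ?_
    gcongr
    refine (hbound s x).trans ?_
    gcongr
    exact (norm_sub_le _ _).trans (add_le_add hx.out le_rfl)
  rcases hcond with ⟨hX, hcont⟩ | ⟨hX, hjoint⟩ | ⟨hX, hsep, hequi⟩ | ⟨hX, hsep, hquasi⟩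
  · refine key _ hX fun y => ?_
    let _ := weakTopology C
    refine ⟨BoundedContinuousFunction.ofNormedAddCommGroup (fun s => inner ℂ y (T s c : H))
      ((continuous_inner_weakTopology C y).comp hcont) (‖y‖ * r) fun s => ?_, trivial,
      fun s => rfl⟩
    exact (norm_inner_le_norm _ _).trans (by gcongr; exact hr s)
  · exact key _ hX fun y => @exists_mem_LUCSpace S _ _ _ C (weakTopology C) T _ c _ hrep
      (hcompact r) hr hjoint (continuous_inner_weakTopology C y)
  · refine key _ hX fun y => @exists_mem_APSpace S _ _ _ C (weakTopology C) T _ c _ hrep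
      (hcompact r) hr hsep (continuous_inner_weakTopology C y) _ (hM y) ?_
    intro x U hU
    -- Weak uniform continuity of `⟪y, ·⟫` passes equicontinuity from the action to the scalar
    -- functions.
    exact hequi x _ (uniformContinuous_inner_weakUniformSpace C y hU)
  · exact key _ hX fun y => @exists_mem_WAPSpace S _ _ _ C (weakTopology C) T _ c _
      (t2Space_weakTopology C) hrep (hcompact r) hr hsep (continuous_inner_weakTopology C y) _
      (hM y) (fun x => {z | ‖(z : H)‖ ≤ r + ‖(x : H) - c‖}) (fun x => hcompact _) hbound hquasi
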